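/- **Setting.** Let $n\ge 1$, let $(\mathbf X_i,Y_i)$, $1\le i\le n$, be independent pairs (for instance i.i.d. pairs, or a deterministic design) with $\mathbf X_i=(X_{i1},\dots,X_{iM})\in\mathbb R^M$ and $Y_i\in\{0,1\}$. Let $I^*\subseteq\{1,\dots,M\}$ have cardinality $k^*$, let $\beta^*\in\mathbb R^M$ satisfy $\beta^*_j=0$ for $j\notin I^*$, and suppose $$\mathbb E(Y_i\mid \mathbf X_i=x)=\frac{\exp(\sum_{j\in I^*}\beta^*_jx_j)}{1+\exp(\sum_{j\in I^*}\beta^*_jx_j)},\qquad 1\le i\le n .$$ Suppose that $|X_{ij}|\le L$ almost surely for all $i,j$, where $L>0$. For $a\in\mathbb R^M$ put $|a|_1=\sum_{j=1}^M|a_j|$, and write $M\vee n=\max(M,n)$. Let $\Sigma$ be the $M\times M$ matrix with entries $\frac1n\sum_{i=1}^nX_{ik}X_{ij}$. For $r,c>0$ let $$\tilde\beta=\arg\min_{\beta\in\mathbb R^M}\ \frac1n\sum_{i=1}^n\Big\{-Y_i\sum_{j=1}^M\beta_jX_{ij}+\log\Big(1+\exp\sum_{j=1}^M\beta_jX_{ij}\Big)\Big\}+2r\sum_{j=1}^M|\beta_j|+c\sum_{j=1}^M\beta_j^2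 .$$ *Condition Stabil* for $\alpha,\epsilon$ holds with constant $b$ if $$\mathbb P\Big(v'\Sigma v\ge b\sum_{j\in I^*}v_j^2-\epsilon\Big)=1\quad\text{for every } v\in V_{\alpha,\epsilon}=\Big\{v\in\mathbb R^M:\sum_{j\notin I^*}|v_j|\le\alpha\sum_{j\in I^*}|v_j|+\epsilon\Big\}.$$ **Theorem 2.7.** There is a constant $s=s(L,D)>0$, depending only on $L>0$ and $D>0$ and decreasing in $D$, such that the following holds. Let $0<\delta<1$, $D>0$, $B>0$, $0<b\le1$, and suppose that $|\beta^*|_1\le D$ and $\max_j|\beta^*_j|\le B$. Let $$r\ge(6+4\sqrt2)L\sqrt{\frac{2\log(2(M\vee n))}{n}}+\frac1{4(M\vee n)}+2L\sqrt{\frac{2\log(1/\delta)}{n}},\qquad c=\frac r{2B},\qquad \epsilon=\frac{\log2}{2^{(M\vee n)+1}}\cdot\frac1r ,$$ and suppose that Condition Stabil for $\alpha=4$ and this $\epsilon$ holds with constant $b$. Then $$\mathbb P\left(|\tilde\beta-\beta^*|_1\le\frac{4.25\,rk^*}{sb+c}+\Big(1+\frac1r\Big)\epsilon\right)\ge1-\delta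 .$$ -/

import Mathlib

open MeasureTheory ProbabilityTheory

noncomputable section

namespace ElasticNetLogistic

/-- The `ℓ₁` norm `|a|₁ = ∑ⱼ |aⱼ|` on `ℝ^M`. -/
def l1Norm {M : ℕ} (a : Fin M → ℝ) : ℝ := ∑ j, |a j|

/-- The logistic link `g(z) = e^z / (1 + e^z)`. -/
def link (z : ℝ) : ℝ := Real.exp z / (1 + Real.exp z)

/-- The logistic loss `l(β; x, y) = -y β'x + log (1 + exp β'x)`. -/
def logisticLoss {M : ℕ} (β x : Fin M → ℝ) (y : ℝ) : ℝ :=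
  -y * (∑ j, β j * x j) + Real.log (1 + Real.exp (∑ j, β j * x j))

/-- The `ℓ₁ + ℓ₂` penalized empirical logistic risk of `β` for the data `(xᵢ, yᵢ)`, `1 ≤ i ≤ n`,
with tuning parameters `r` and `c`. -/
def criterion {n M : ℕ} (x : Fin n → Fin M → ℝ) (y : Fin n → ℝ) (r c : ℝ) (β : Fin M → ℝ) : ℝ :=
  (1 / (n : ℝ)) * ∑ i, logisticLoss β (x i) (y i) + 2 * r * ∑ j, |β j| + c * ∑ j, β j ^ 2

/-- `β` is the `ℓ₁ + ℓ₂` penalized logistic regression estimate for the data `(xᵢ, yᵢ)`: a global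
minimizer of the criterion. -/
def IsEstimate {n M : ℕ} (x : Fin n → Fin M → ℝ) (y : Fin n → ℝ) (r c : ℝ) (β : Fin M → ℝ) :
    Prop :=
  ∀ β' : Fin M → ℝ, criterion x y r c β ≤ criterion x y r c β'

/-- The set `V_{α,ε} = {v ∈ ℝ^M : ∑_{j ∉ I} |vⱼ| ≤ α ∑_{j ∈ I} |vⱼ| + ε}`. -/
def coneSet {M : ℕ} (I : Finset (Fin M)) (α ε : ℝ) : Set (Fin M → ℝ) :=
  {v | ∑ j ∈ Iᶜ, |v j| ≤ α * ∑ j ∈ I, |v j| + ε}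

/-- The matrix `Σ` of the design, with entries `ρ_{kj} = (1/n) ∑ᵢ x_{ik} x_{ij}`. -/
def gram {n M : ℕ} (x : Fin n → Fin M → ℝ) : Matrix (Fin M) (Fin M) ℝ :=
  Matrix.of fun k j => (1 / (n : ℝ)) * ∑ i, x i k * x i j

/-- Condition Stabil with constant `b`, for the index set `I` and the parameters `α`, `ε`: for any
`v ∈ V_{α,ε}`, with probability one, `v'Σv ≥ b ∑_{j ∈ I} vⱼ² - ε`. -/
def Stabil {Ω : Type*} [MeasurableSpace Ω] (μ : Measure Ω) {n M : ℕ}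
    (X : Fin n → Ω → Fin M → ℝ) (I : Finset (Fin M)) (α ε b : ℝ) : Prop :=
  ∀ v ∈ coneSet I α ε, ∀ᵐ ω ∂μ,
    b * ∑ j ∈ I, v j ^ 2 - ε ≤ v ⬝ᵥ (gram (fun i => X i ω)).mulVec v

/-- The logistic regression model: the pairs `(Xᵢ, Yᵢ)` are independent, `Yᵢ ∈ {0, 1}`, and
`E(Yᵢ | Xᵢ = x) = g(∑_{j ∈ I} βⱼ xⱼ)`, where `β` vanishes outside `I`. -/
structure IsLogisticSample {Ω : Type*} [MeasurableSpace Ω] (μ : Measure Ω) {n M : ℕ}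
    (X : Fin n → Ω → Fin M → ℝ) (Y : Fin n → Ω → ℝ) (I : Finset (Fin M)) (β : Fin M → ℝ) :
    Prop where
  measurable_X : ∀ i, Measurable (X i)
  measurable_Y : ∀ i, Measurable (Y i)
  indep : iIndepFun (fun i ω => (X i ω, Y i ω)) μ
  binary : ∀ i, ∀ᵐ ω ∂μ, Y i ω = 0 ∨ Y i ω = 1
  condExp_eq : ∀ i, μ[Y i | MeasurableSpace.comap (X i) inferInstance] =ᵐ[μ]
    fun ω => link (∑ j ∈ I, β j * X i ω j)
  eq_zero : ∀ j, j ∉ I → β j = 0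

/-- The lower bound required of the tuning parameter `r`, where `M ∨ n = max M n`. -/
def rMin (L : ℝ) (n M : ℕ) (δ : ℝ) : ℝ :=
  (6 + 4 * √2) * L * √(2 * Real.log (2 * (max M n : ℕ)) / n)
    + 1 / (4 * (max M n : ℕ)) + 2 * L * √(2 * Real.log (1 / δ) / n)

/-- `ε = (log 2 / 2^{(M ∨ n) + 1}) · (1 / r)`. -/
def eps (n M : ℕ) (r : ℝ) : ℝ := Real.log 2 / 2 ^ (max M n + 1) * (1 / r)

end ElasticNetLogistic

end

noncomputable section

namespace ElasticNetLogistic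

/-! The proof separates a deterministic inequality from a probability bound. Suppose the score at
`βstar`, divided by `n`, is at most `r / 2` in sup norm, and put `u = βtilde - βstar`. Convexity of
the risk and minimality of `βtilde` first give `|u|₁ ≤ 3D`, so all linear predictors lie in `[-4LD,
4LD]`. There the logistic loss is strongly convex, which produces `s = exp(-4LD) / 8`. Minimality
then bounds `s u'Σu + c ∑_I uⱼ² + (3/2) r |u|₁` by `5 r ∑_I |uⱼ|`. This puts `u` in the cone, and
Condition Stabil with Cauchy–Schwarz absorbs the right side (`l1Norm_estimate_sub_le`).

The score is a sum of independent centred terms bounded by `L`, so Hoeffding's inequality and a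
union bound over coordinates control it with probability at least `1 - δ`
(`measureReal_exists_score_ge_le`, `two_mul_exp_le_of_rMin_le`). As `u` is random, Stabil is first
made uniform over the cone (`Stabil.ae_forall`). -/

theorem link_pos (z : ℝ) : 0 < link z := by unfold link; positivity

theorem link_lt_one (z : ℝ) : link z < 1 := by
  unfold link
  rw [div_lt_one (by positivity)]
  linarith

theorem hasDerivAt_log_one_add_exp (z : ℝ) :
    HasDerivAt (fun z => Real.log (1 + Real.exp z)) (link z) z :=
  ((Real.hasDerivAt_exp z).const_add 1).log (by positivity)

theorem hasDerivAt_link (z : ℝ) :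
    HasDerivAt link (Real.exp z / (1 + Real.exp z) ^ 2) z := by
  have h := (Real.hasDerivAt_exp z).div ((Real.hasDerivAt_exp z).const_add 1)
    (by positivity : (1 + Real.exp z) ≠ 0)
  refine h.congr_deriv ?_
  congr 1
  ring

theorem measurable_link : Measurable link :=
  (continuous_iff_continuousAt.2 fun z => (hasDerivAt_link z).continuousAt).measurable

/-- Lower bound for the derivative of the logistic link on `[-A, A]`. -/
theorem exp_neg_div_four_le {A z : ℝ} (hz : |z| ≤ A) :
    Real.exp (-A) / 4 ≤ Real.exp z / (1 + Real.exp z) ^ 2 := by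
  obtain ⟨h1, h2⟩ := abs_le.1 hz
  rw [div_le_div_iff₀ (by norm_num) (by positivity)]
  have ha : Real.exp (-A) ≤ Real.exp z := Real.exp_le_exp.2 h1
  have hb : Real.exp (-A) * Real.exp z ≤ 1 := by
    rw [← Real.exp_add]
    exact Real.exp_le_one_iff.2 (by linarith)
  have hc : Real.exp (-A) ≤ 1 := Real.exp_le_one_iff.2 (by linarith [abs_nonneg z])
  have hp := Real.exp_pos z
  nlinarith [mul_le_mul_of_nonneg_right hb hp.le, mul_le_mul_of_nonneg_right hc hp.le]

/-- Strong convexity of `log (1 + exp z)` on `[-A, A]`. -/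
theorem log_one_add_exp_sub_ge {A z w : ℝ} (hz : |z| ≤ A) (hw : |w| ≤ A) :
    link z * (w - z) + Real.exp (-A) / 8 * (w - z) ^ 2 ≤
      Real.log (1 + Real.exp w) - Real.log (1 + Real.exp z) := by
  set s := Real.exp (-A) / 8 with hs
  have hd1 : ∀ z, HasDerivAt (fun z => Real.log (1 + Real.exp z) - s * z ^ 2)
      (link z - 2 * s * z) z := fun z =>
    ((hasDerivAt_log_one_add_exp z).sub ((hasDerivAt_pow 2 z).const_mul s)).congr_deriv
      (by norm_num; ring)
  have hd2 : ∀ z, HasDerivAt (fun z => link z - 2 * s * z)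
      (Real.exp z / (1 + Real.exp z) ^ 2 - 2 * s) z := fun z =>
    ((hasDerivAt_link z).sub ((hasDerivAt_id z).const_mul (2 * s))).congr_deriv (by simp)
  have e1 : deriv (fun z => Real.log (1 + Real.exp z) - s * z ^ 2) =
      fun z => link z - 2 * s * z := funext fun z => (hd1 z).deriv
  have hconv : ConvexOn ℝ (Set.Icc (-A) A)
      (fun z => Real.log (1 + Real.exp z) - s * z ^ 2) := by
    refine convexOn_of_deriv2_nonneg' (convex_Icc _ _)
      (fun z _ => (hd1 z).differentiableAt.differentiableWithinAt) ?_ ?_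
    · rw [e1]
      exact fun z _ => (hd2 z).differentiableAt.differentiableWithinAt
    · intro x hx
      simp only [Function.iterate_succ, Function.iterate_zero, Function.comp, id, e1]
      rw [(hd2 x).deriv]
      have := exp_neg_div_four_le (abs_le.2 ⟨hx.1, hx.2⟩)
      linarith
  have hz' := abs_le.1 hz
  have hw' := abs_le.1 hw
  rcases lt_trichotomy z w with h | h | h
  · have := hconv.le_slope_of_hasDerivAt hz' hw' h (hd1 z)
    rw [slope_def_field, le_div_iff₀ (by linarith)] at this
    nlinarith
  · subst h; simp
  · have := hconv.slope_le_of_hasDerivAt hw' hz' h (hd1 z)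
    rw [slope_def_field, div_le_iff₀ (by linarith)] at this
    nlinarith

/-! ### Norms, the Gram form and increments of the empirical risk -/

theorem l1Norm_nonneg {M : ℕ} (a : Fin M → ℝ) : 0 ≤ l1Norm a :=
  Finset.sum_nonneg fun _ _ => abs_nonneg _

theorem l1Norm_eq_add_compl {M : ℕ} (I : Finset (Fin M)) (a : Fin M → ℝ) :
    l1Norm a = ∑ j ∈ I, |a j| + ∑ j ∈ Iᶜ, |a j| :=
  (Finset.sum_add_sum_compl I _).symm

theorem l1Norm_add_le {M : ℕ} (a b : Fin M → ℝ) : l1Norm (a + b) ≤ l1Norm a + l1Norm b := by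
  unfold l1Norm
  rw [← Finset.sum_add_distrib]
  exact Finset.sum_le_sum fun j _ => abs_add_le _ _

theorem abs_sum_mul_le {M : ℕ} (a x : Fin M → ℝ) {L : ℝ} (hx : ∀ j, |x j| ≤ L) :
    |∑ j, a j * x j| ≤ L * l1Norm a := by
  unfold l1Norm
  rw [Finset.mul_sum]
  refine (Finset.abs_sum_le_sum_abs _ _).trans (Finset.sum_le_sum fun j _ => ?_)
  rw [abs_mul, mul_comm]
  exact mul_le_mul_of_nonneg_right (hx j) (abs_nonneg _)

theorem dotProduct_gram_mulVec {n M : ℕ} (x : Fin n → Fin M → ℝ) (v : Fin M → ℝ) :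
    v ⬝ᵥ (gram x).mulVec v = (1 / (n : ℝ)) * ∑ i, (∑ j, v j * x i j) ^ 2 := by
  simp only [dotProduct, Matrix.mulVec, gram, Matrix.of_apply, Finset.mul_sum, sq]
  simp_rw [Finset.sum_mul, Finset.mul_sum]
  symm
  rw [Finset.sum_comm]
  refine Finset.sum_congr rfl fun j _ => ?_
  rw [Finset.sum_comm]
  refine Finset.sum_congr rfl fun k _ => ?_
  refine Finset.sum_congr rfl fun i _ => ?_
  ring

/-- Lower bound for the increment of the empirical logistic risk, given a bound on its gradient. -/
theorem logisticRisk_sub_ge {n M : ℕ} (x : Fin n → Fin M → ℝ) (y : Fin n → ℝ)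
    (β β' : Fin M → ℝ) {A t : ℝ} (hn : 1 ≤ n)
    (hgrad : ∀ j, |∑ i, (y i - link (∑ k, β k * x i k)) * x i j| ≤ n * t)
    (hβ : ∀ i, |∑ j, β j * x i j| ≤ A) (hβ' : ∀ i, |∑ j, β' j * x i j| ≤ A) :
    Real.exp (-A) / 8 * ((β' - β) ⬝ᵥ (gram x).mulVec (β' - β)) - t * l1Norm (β' - β) ≤
      (1 / (n : ℝ)) * ∑ i, logisticLoss β' (x i) (y i) -
        (1 / (n : ℝ)) * ∑ i, logisticLoss β (x i) (y i) := by
  have hn0 : (0 : ℝ) < n := by exact_mod_cast hn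
  have hdiff : ∀ i, ∑ j, (β' - β) j * x i j = ∑ j, β' j * x i j - ∑ j, β j * x i j := by
    intro i
    rw [← Finset.sum_sub_distrib]
    exact Finset.sum_congr rfl fun j _ => by simp [sub_mul]
  have hlin : ∑ i, (y i - link (∑ k, β k * x i k)) * (∑ j, (β' - β) j * x i j) ≤
      n * t * l1Norm (β' - β) := by
    simp_rw [Finset.mul_sum]
    rw [Finset.sum_comm, l1Norm, Finset.mul_sum]
    refine Finset.sum_le_sum fun j _ => ?_
    calc ∑ i, (y i - link (∑ k, β k * x i k)) * ((β' - β) j * x i j)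
        = (∑ i, (y i - link (∑ k, β k * x i k)) * x i j) * (β' - β) j := by
          rw [Finset.sum_mul]
          exact Finset.sum_congr rfl fun i _ => by ring
      _ ≤ |(∑ i, (y i - link (∑ k, β k * x i k)) * x i j) * (β' - β) j| := le_abs_self _
      _ ≤ n * t * |(β' - β) j| := by
          rw [abs_mul]
          exact mul_le_mul_of_nonneg_right (hgrad j) (abs_nonneg _)
  -- The `-y` part of the loss joins the tangent slope `link` to form the score; the quadratic
  -- remainders sum to the Gram form.
  have hterm : ∑ i, (Real.exp (-A) / 8 * (∑ j, (β' - β) j * x i j) ^ 2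
        - (y i - link (∑ k, β k * x i k)) * (∑ j, (β' - β) j * x i j)) ≤
      ∑ i, (logisticLoss β' (x i) (y i) - logisticLoss β (x i) (y i)) := by
    refine Finset.sum_le_sum fun i _ => ?_
    have := log_one_add_exp_sub_ge (hβ i) (hβ' i)
    rw [hdiff]
    unfold logisticLoss
    nlinarith
  rw [dotProduct_gram_mulVec, ← mul_sub, ← Finset.sum_sub_distrib]
  rw [Finset.sum_sub_distrib, ← Finset.mul_sum] at hterm
  calc _ = (1 / (n : ℝ)) * (Real.exp (-A) / 8 * ∑ i, (∑ j, (β' - β) j * x i j) ^ 2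
          - n * t * l1Norm (β' - β)) := by
        field_simp
    _ ≤ _ := mul_le_mul_of_nonneg_left (by linarith) (by positivity)

/-! ### Deterministic bound on the estimation error -/

/-- After dividing by `k` in `hS`, this is completing the square; `k = 0` forces `S = 0`. It trades
the `ℓ₁` error on the support for the quadratic terms. -/
theorem five_mul_mul_le {q N S r : ℝ} {k : ℕ} (hq : 0 < q) (hN : 0 ≤ N) (hS : S ^ 2 ≤ k * N) :
    5 * r * S ≤ q * N + 25 / 4 * (r ^ 2 * k / q) := by
  rcases Nat.eq_zero_or_pos k with hk | hk
  · have hS0 : S = 0 := by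
      subst hk
      simpa using le_antisymm (by simpa using hS) (sq_nonneg S)
    rw [hS0, mul_zero]
    positivity
  · have hk' : (0 : ℝ) < k := by exact_mod_cast hk
    have h1 : S ^ 2 / k ≤ N := by rw [div_le_iff₀ hk']; linarith
    have h2 : q * (S ^ 2 / k) + 25 / 4 * (r ^ 2 * k / q) - 5 * r * S =
        (q * S - 5 / 2 * r * k) ^ 2 / (q * k) := by
      field_simp
      ring
    have h3 : 0 ≤ (q * S - 5 / 2 * r * k) ^ 2 / (q * k) := by positivity
    have h4 := mul_le_mul_of_nonneg_left h1 hq.le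
    linarith

/-- The part of the analysis that holds for every sample on which the gradient of the empirical risk
at the true parameter is at most `r / 2` in sup norm. -/
theorem l1Norm_estimate_sub_le {n M : ℕ} (x : Fin n → Fin M → ℝ) (y : Fin n → ℝ)
    (I : Finset (Fin M)) (β β' : Fin M → ℝ) {L D B b r c ε : ℝ} (hn : 1 ≤ n)
    (hL : 0 < L) (hB : 0 < B) (hb : 0 < b) (hr : 0 < r) (hε : 0 ≤ ε) (hc : c = r / (2 * B))
    (hx : ∀ i j, |x i j| ≤ L) (hβ : l1Norm β ≤ D) (hβB : ∀ j, |β j| ≤ B)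
    (hβI : ∀ j, j ∉ I → β j = 0)
    (hgrad : ∀ j, |∑ i, (y i - link (∑ k, β k * x i k)) * x i j| ≤ n * (r / 2))
    (hstabil : ∀ v ∈ coneSet I 4 ε, b * ∑ j ∈ I, v j ^ 2 - ε ≤ v ⬝ᵥ (gram x).mulVec v)
    (hβ' : IsEstimate x y r c β') :
    l1Norm (β' - β) ≤
      4.25 * r * (I.card : ℝ) / (Real.exp (-(4 * L * D)) / 8 * b + c) + (1 + 1 / r) * ε := by
  set u := β' - β with hu
  have hD : 0 ≤ D := (l1Norm_nonneg β).trans hβ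
  have hc0 : 0 < c := by rw [hc]; positivity
  have hcB : 2 * c * B = r := by rw [hc]; field_simp
  have hmin := hβ' β
  unfold criterion at hmin
  have hz : ∀ i, |∑ j, β j * x i j| ≤ L * D := fun i =>
    (abs_sum_mul_le β (x i) (hx i)).trans (mul_le_mul_of_nonneg_left hβ hL.le)
  have hl1 : l1Norm β' ≤ l1Norm u + l1Norm β := by
    have := l1Norm_add_le u β
    rwa [hu, sub_add_cancel] at this
  have hl1' : l1Norm u ≤ l1Norm β' + l1Norm β := by
    have := l1Norm_add_le β' (-β)
    rw [← sub_eq_add_neg] at this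
    simpa [l1Norm, hu] using this
  have hw : ∀ i, |∑ j, β' j * x i j| ≤ L * (l1Norm u + D) := fun i =>
    (abs_sum_mul_le β' (x i) (hx i)).trans (mul_le_mul_of_nonneg_left (by linarith) hL.le)
  have hquad : 0 ≤ u ⬝ᵥ (gram x).mulVec u := by
    rw [dotProduct_gram_mulVec]; positivity
  -- a first bound on the estimation error
  have hsq : c * ∑ j, β j ^ 2 ≤ r / 2 * D := by
    have : ∑ j, β j ^ 2 ≤ B * l1Norm β := by
      rw [l1Norm, Finset.mul_sum]
      refine Finset.sum_le_sum fun j _ => ?_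
      rw [← sq_abs, sq]
      exact mul_le_mul_of_nonneg_right (hβB j) (abs_nonneg _)
    calc c * ∑ j, β j ^ 2 ≤ c * (B * l1Norm β) := mul_le_mul_of_nonneg_left this hc0.le
      _ = r / 2 * l1Norm β := by rw [← hcB]; ring
      _ ≤ _ := mul_le_mul_of_nonneg_left hβ (by positivity)
  -- The curvature is dropped here, since its interval still depends on `u`. What remains is `(3/2)
  -- r |u|₁ ≤ (4 + 1/2) r D`.
  have hcrude : l1Norm u ≤ 3 * D := by
    have h := logisticRisk_sub_ge x y β β' (A := L * (l1Norm u + D)) hn hgrad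
      (fun i => (hz i).trans (mul_le_mul_of_nonneg_left
        (by linarith [l1Norm_nonneg u]) hL.le)) hw
    have h0 : 0 ≤ Real.exp (-(L * (l1Norm u + D))) / 8 * (u ⬝ᵥ (gram x).mulVec u) := by
      positivity
    have h1 : 0 ≤ c * ∑ j, β' j ^ 2 := by positivity
    change _ + 2 * r * l1Norm β' + _ ≤ _ + 2 * r * l1Norm β + _ at hmin
    have h2 : r * (3 * l1Norm u) ≤ r * (9 * D) := by
      have := mul_le_mul_of_nonneg_left hβ hr.le
      have := mul_le_mul_of_nonneg_left hl1' hr.le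
      linarith
    linarith [le_of_mul_le_mul_left h2 hr]
  have hrisk := logisticRisk_sub_ge x y β β' (A := 4 * L * D) hn hgrad
    (fun i => (hz i).trans (by nlinarith)) (fun i => (hw i).trans (by nlinarith))
  rw [← hu] at hrisk
  set s := Real.exp (-(4 * L * D)) / 8 with hs
  have hs0 : 0 < s := by positivity
  have hs1 : s ≤ 1 := by
    have : Real.exp (-(4 * L * D)) ≤ 1 := Real.exp_le_one_iff.2 (by
      have : 0 ≤ 4 * L * D := by positivity
      linarith)
    linarith
  set S := ∑ j ∈ I, |u j| with hS
  set T := ∑ j ∈ Iᶜ, |u j| with hT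
  set N := ∑ j ∈ I, u j ^ 2 with hN
  have hST : l1Norm u = S + T := l1Norm_eq_add_compl I u
  have hS0 : 0 ≤ S := Finset.sum_nonneg fun _ _ => abs_nonneg _
  have hT0 : 0 ≤ T := Finset.sum_nonneg fun _ _ => abs_nonneg _
  have hN0 : 0 ≤ N := Finset.sum_nonneg fun _ _ => sq_nonneg _
  have hpen1 : T - S ≤ ∑ j, |β' j| - ∑ j, |β j| := by
    rw [← Finset.sum_add_sum_compl I (fun j => |β' j|),
      ← Finset.sum_add_sum_compl I (fun j => |β j|)]
    have h1 : ∑ j ∈ Iᶜ, |β' j| = T := Finset.sum_congr rfl fun j hj => by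
      simp [hu, hβI j (Finset.mem_compl.1 hj)]
    have h2 : ∑ j ∈ Iᶜ, |β j| = 0 := Finset.sum_eq_zero fun j hj => by
      simp [hβI j (Finset.mem_compl.1 hj)]
    have h3 : ∑ j ∈ I, |β j| ≤ ∑ j ∈ I, |β' j| + S := by
      rw [hS, ← Finset.sum_add_distrib]
      refine Finset.sum_le_sum fun j _ => ?_
      have := abs_sub_abs_le_abs_sub (β j) (β' j)
      rw [abs_sub_comm] at this
      simp only [hu, Pi.sub_apply]
      linarith
    linarith
  have hpen2 : N - 2 * B * S ≤ ∑ j, β' j ^ 2 - ∑ j, β j ^ 2 := by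
    rw [← Finset.sum_sub_distrib, ← Finset.sum_add_sum_compl I]
    have h1 : 0 ≤ ∑ j ∈ Iᶜ, (β' j ^ 2 - β j ^ 2) := Finset.sum_nonneg fun j hj => by
      rw [hβI j (Finset.mem_compl.1 hj)]
      nlinarith [sq_nonneg (β' j)]
    have h2 : N - 2 * B * S ≤ ∑ j ∈ I, (β' j ^ 2 - β j ^ 2) := by
      rw [hN, hS, Finset.mul_sum, ← Finset.sum_sub_distrib]
      refine Finset.sum_le_sum fun j _ => ?_
      have h3 : -(B * |u j|) ≤ β j * u j := by
        refine neg_le_of_abs_le ?_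
        rw [abs_mul]
        exact mul_le_mul_of_nonneg_right (hβB j) (abs_nonneg _)
      have h4 : β' j = u j + β j := by simp [hu]
      have h5 : (u j + β j) ^ 2 - β j ^ 2 = u j ^ 2 + 2 * (β j * u j) := by ring
      rw [h4, h5]
      linarith
    linarith
  -- The coefficient 5 is 4 from adding `2r(S + T)` to the `ℓ₁` penalty bound, plus 1 from the cross
  -- term `2cBS = rS`. The 3/2 is what the score leaves of 2.
  have hbasic : s * (u ⬝ᵥ (gram x).mulVec u) + c * N + 3 / 2 * r * (S + T) ≤ 5 * r * S := by
    have h1 := mul_le_mul_of_nonneg_left hpen1 (by positivity : 0 ≤ 2 * r)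
    have h2 := mul_le_mul_of_nonneg_left hpen2 hc0.le
    have h3 : c * (N - 2 * B * S) = c * N - r * S := by rw [← hcB]; ring
    rw [hST] at hrisk
    linarith
  have hcone : u ∈ coneSet I 4 ε := by
    change T ≤ 4 * S + ε
    have h0 : 0 ≤ s * (u ⬝ᵥ (gram x).mulVec u) := by positivity
    have h1 : 0 ≤ c * N := by positivity
    have h2 : r * (3 * T) ≤ r * (7 * S) := by linarith
    linarith [le_of_mul_le_mul_left h2 hr]
  have hst : s * (b * N - ε) ≤ s * (u ⬝ᵥ (gram x).mulVec u) :=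
    mul_le_mul_of_nonneg_left (hstabil u hcone) hs0.le
  have hCS : S ^ 2 ≤ I.card * N := by
    have := sq_sum_le_card_mul_sum_sq (s := I) (f := fun j => |u j|)
    simpa [sq_abs] using this
  set q := s * b + c with hq
  have hq0 : 0 < q := by positivity
  have hamgm := five_mul_mul_le hq0 hN0 hCS (r := r)
  have hmain : r * (3 / 2 * (S + T)) ≤ r * (25 / 4 * (r * I.card / q) + s * ε / r) := by
    have h1 : r * (25 / 4 * (r * I.card / q) + s * ε / r) =
        25 / 4 * (r ^ 2 * I.card / q) + s * ε := by
      field_simp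
    have h2 : q * N = s * b * N + c * N := by rw [hq]; ring
    rw [h1]
    linarith
  have hfin := le_of_mul_le_mul_left hmain hr
  have h1 : s * ε / r ≤ 1 / r * ε := by
    rw [one_div_mul_eq_div]
    exact div_le_div_of_nonneg_right (mul_le_of_le_one_left hε hs1) hr.le
  have h2 : 0 ≤ r * I.card / q := by positivity
  have h3 : 4.25 * r * (I.card : ℝ) / q = 4.25 * (r * I.card / q) := by ring
  have h4 : 0 ≤ 1 / r * ε := by positivity
  -- Dividing `hfin` by 3/2 gives the constant 25/6, which is below 4.25.
  rw [hST, h3]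
  norm_num
  norm_num at h4 h1
  linarith

/-! ### Almost sure uniformity and concentration of the score -/

/-- Condition Stabil holds almost surely for all vectors of the cone at once. -/
theorem Stabil.ae_forall {Ω : Type*} [MeasurableSpace Ω] {μ : Measure Ω} {n M : ℕ}
    {X : Fin n → Ω → Fin M → ℝ} {I : Finset (Fin M)} {α ε b : ℝ} (h : Stabil μ X I α ε b) :
    ∀ᵐ ω ∂μ, ∀ v ∈ coneSet I α ε,
      b * ∑ j ∈ I, v j ^ 2 - ε ≤ v ⬝ᵥ (gram (fun i => X i ω)).mulVec v := by
  -- The exceptional null set may depend on `v`. A countable dense subset of the cone costs one null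
  -- set, and both sides are continuous in `v`.
  obtain ⟨t, hts, htc, hst⟩ :=
    (TopologicalSpace.IsSeparable.of_separableSpace (coneSet I α ε)).exists_countable_dense_subset
  have hall : ∀ᵐ ω ∂μ, ∀ v ∈ t,
      b * ∑ j ∈ I, v j ^ 2 - ε ≤ v ⬝ᵥ (gram (fun i => X i ω)).mulVec v :=
    (ae_ball_iff htc).2 fun v hv => h v (hts hv)
  filter_upwards [hall] with ω hω v hv
  have hcl : IsClosed {v : Fin M → ℝ |
      b * ∑ j ∈ I, v j ^ 2 - ε ≤ v ⬝ᵥ (gram (fun i => X i ω)).mulVec v} := by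
    refine isClosed_le (by fun_prop) ?_
    simp_rw [dotProduct_gram_mulVec]
    fun_prop
  exact closure_minimal hω hcl (hst hv)

/-- Two-sided Hoeffding inequality for independent centred variables bounded by `L`. -/
theorem measureReal_abs_sum_ge_le {Ω : Type*} [MeasurableSpace Ω] {μ : Measure Ω}
    [IsProbabilityMeasure μ] {n : ℕ} {ξ : Fin n → Ω → ℝ} (hind : iIndepFun ξ μ)
    (hm : ∀ i, Measurable (ξ i)) {L : ℝ} (hL : 0 < L) (hb : ∀ i, ∀ᵐ ω ∂μ, |ξ i ω| ≤ L)
    (h0 : ∀ i, μ[ξ i] = 0) {t : ℝ} (ht : 0 ≤ t) :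
    μ.real {ω | t ≤ |∑ i, ξ i ω|} ≤ 2 * Real.exp (-t ^ 2 / (2 * (n * L ^ 2))) := by
  have hsub : ∀ i, HasSubgaussianMGF (ξ i) ((‖L - -L‖₊ / 2) ^ 2) μ := fun i =>
    hasSubgaussianMGF_of_mem_Icc_of_integral_eq_zero (hm i).aemeasurable
      ((hb i).mono fun ω hω => abs_le.1 hω) (h0 i)
  have hconst : ((∑ _i : Fin n, (‖L - -L‖₊ / 2) ^ 2 : NNReal) : ℝ) = n * L ^ 2 := by
    have : |L + L| / 2 = L := by rw [abs_of_pos (by linarith)]; ring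
    simp [this]
  have h1 := HasSubgaussianMGF.measure_sum_ge_le_of_iIndepFun hind (s := Finset.univ)
    (fun i _ => hsub i) ht
  have hind' : iIndepFun (fun i => -ξ i) μ :=
    hind.comp (fun _ x => -x) (fun _ => measurable_neg)
  have h2 := HasSubgaussianMGF.measure_sum_ge_le_of_iIndepFun hind' (s := Finset.univ)
    (fun i _ => (hsub i).neg) ht
  rw [hconst] at h1 h2
  have hsubset : {ω | t ≤ |∑ i, ξ i ω|} ⊆
      {ω | t ≤ ∑ i, ξ i ω} ∪ {ω | t ≤ ∑ i, (-ξ i) ω} := by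
    intro ω hω
    simpa [le_abs] using hω
  calc _ ≤ _ := measureReal_mono hsubset
    _ ≤ _ := measureReal_union_le _ _
    _ ≤ _ := by linarith

namespace IsLogisticSample

variable {Ω : Type*} [MeasurableSpace Ω] {μ : Measure Ω} {n M : ℕ}
  {X : Fin n → Ω → Fin M → ℝ} {Y : Fin n → Ω → ℝ} {I : Finset (Fin M)} {β : Fin M → ℝ}

theorem sum_eq (h : IsLogisticSample μ X Y I β) (x : Fin M → ℝ) :
    ∑ j ∈ I, β j * x j = ∑ j, β j * x j :=
  Finset.sum_subset (Finset.subset_univ I) fun j _ hj => by rw [h.eq_zero j hj, zero_mul]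

/-- Conditioning on `X i` pulls the bounded factor `X i ω j` out and replaces `Y i` by the link. -/
theorem integral_score_eq_zero [IsProbabilityMeasure μ] (h : IsLogisticSample μ X Y I β) {L : ℝ}
    (hX : ∀ i j, ∀ᵐ ω ∂μ, |X i ω j| ≤ L) (i : Fin n) (j : Fin M) :
    ∫ ω, (Y i ω - link (∑ k, β k * X i ω k)) * X i ω j ∂μ = 0 := by
  have hm : MeasurableSpace.comap (X i) inferInstance ≤ (inferInstance : MeasurableSpace Ω) :=
    (h.measurable_X i).comap_le
  have hXm : Measurable fun ω => X i ω j := (measurable_pi_apply j).comp (h.measurable_X i)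
  have hYb : ∀ᵐ ω ∂μ, ‖Y i ω‖ ≤ 1 := (h.binary i).mono fun ω hω => by
    rcases hω with hω | hω <;> simp [hω]
  have hYi : Integrable (Y i) μ :=
    Integrable.of_bound (h.measurable_Y i).aestronglyMeasurable 1 hYb
  have hXi : Integrable (fun ω => X i ω j) μ :=
    Integrable.of_bound hXm.aestronglyMeasurable L (hX i j)
  have hXY : Integrable ((fun ω => X i ω j) * Y i) μ :=
    hXi.mul_bdd (c := 1) (h.measurable_Y i).aestronglyMeasurable hYb
  have hlm : Measurable fun ω => link (∑ k, β k * X i ω k) :=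
    measurable_link.comp (Finset.measurable_sum _ fun k _ =>
      ((measurable_pi_apply k).comp (h.measurable_X i)).const_mul _)
  have hXl : Integrable (fun ω => X i ω j * link (∑ k, β k * X i ω k)) μ :=
    hXi.mul_bdd (c := 1) hlm.aestronglyMeasurable (Filter.Eventually.of_forall fun ω => by
      rw [Real.norm_eq_abs, abs_of_pos (link_pos _)]
      exact (link_lt_one _).le)
  have hpull := condExp_mul_of_stronglyMeasurable_left
    (m := MeasurableSpace.comap (X i) inferInstance) (f := fun ω => X i ω j) (g := Y i)
    ((measurable_pi_apply j).comp (comap_measurable (X i))).stronglyMeasurable hXY hYi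
  have key : ∫ ω, X i ω j * Y i ω ∂μ = ∫ ω, X i ω j * link (∑ k, β k * X i ω k) ∂μ := by
    rw [← integral_condExp hm (f := fun ω => X i ω j * Y i ω)]
    refine integral_congr_ae ?_
    filter_upwards [hpull, h.condExp_eq i] with ω h1 h2
    refine h1.trans ?_
    rw [Pi.mul_apply, h2, h.sum_eq]
  calc _ = ∫ ω, (X i ω j * Y i ω - X i ω j * link (∑ k, β k * X i ω k)) ∂μ := by
        congr 1; ext ω; ring
    _ = 0 := by exact (integral_sub hXY hXl).trans (sub_eq_zero.2 key)

/-- Each coordinate of the score at the true parameter concentrates around zero. -/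
theorem measureReal_score_ge_le [IsProbabilityMeasure μ] (h : IsLogisticSample μ X Y I β) {L : ℝ} (hL : 0 < L)
    (hX : ∀ i j, ∀ᵐ ω ∂μ, |X i ω j| ≤ L) (j : Fin M) {t : ℝ} (ht : 0 ≤ t) :
    μ.real {ω | t ≤ |∑ i, (Y i ω - link (∑ k, β k * X i ω k)) * X i ω j|} ≤
      2 * Real.exp (-t ^ 2 / (2 * (n * L ^ 2))) := by
  have hg : Measurable fun p : (Fin M → ℝ) × ℝ => (p.2 - link (∑ k, β k * p.1 k)) * p.1 j := by
    have h1 : Measurable fun p : (Fin M → ℝ) × ℝ => link (∑ k, β k * p.1 k) :=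
      measurable_link.comp (by fun_prop)
    exact (measurable_snd.sub h1).mul (by fun_prop)
  have hm : ∀ i, Measurable fun ω => (Y i ω - link (∑ k, β k * X i ω k)) * X i ω j := fun i =>
    hg.comp ((h.measurable_X i).prodMk (h.measurable_Y i))
  refine measureReal_abs_sum_ge_le
    (ξ := fun i ω => (Y i ω - link (∑ k, β k * X i ω k)) * X i ω j)
    (h.indep.comp _ fun _ => hg) hm hL (fun i => ?_) (h.integral_score_eq_zero hX · j) ht
  filter_upwards [h.binary i, hX i j] with ω hY hXω
  have h1 := link_pos (∑ k, β k * X i ω k)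
  have h2 := link_lt_one (∑ k, β k * X i ω k)
  have h3 : |Y i ω - link (∑ k, β k * X i ω k)| ≤ 1 := by
    rw [abs_le]
    rcases hY with hY | hY <;> rw [hY] <;> constructor <;> linarith
  rw [abs_mul]
  calc _ ≤ 1 * L := mul_le_mul h3 hXω (abs_nonneg _) zero_le_one
    _ = L := one_mul L

/-- Uniform concentration of the score at the true parameter. -/
theorem measureReal_exists_score_ge_le [IsProbabilityMeasure μ] (h : IsLogisticSample μ X Y I β) {L : ℝ} (hL : 0 < L)
    (hX : ∀ i j, ∀ᵐ ω ∂μ, |X i ω j| ≤ L) {t : ℝ} (ht : 0 ≤ t) :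
    μ.real {ω | ∃ j, t ≤ |∑ i, (Y i ω - link (∑ k, β k * X i ω k)) * X i ω j|} ≤
      2 * M * Real.exp (-t ^ 2 / (2 * (n * L ^ 2))) := by
  rw [Set.ofPred_exists]
  refine (measureReal_iUnion_fintype_le _).trans
    ((Finset.sum_le_sum fun j _ => h.measureReal_score_ge_le hL hX j ht).trans_eq ?_)
  rw [Finset.sum_const, Finset.card_univ, Fintype.card_fin, nsmul_eq_mul]
  ring

end IsLogisticSample

/-- The level `r / 2` is exceeded by the score with probability at most `δ`. -/
theorem two_mul_exp_le_of_rMin_le {L δ r : ℝ} {n M : ℕ} (hn : 1 ≤ n) (hL : 0 < L) (hδ : 0 < δ)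
    (hδ1 : δ < 1) (hr : rMin L n M δ ≤ r) :
    0 < r ∧ 2 * M * Real.exp (-(n * (r / 2)) ^ 2 / (2 * (n * L ^ 2))) ≤ δ := by
  set m : ℕ := max M n with hm
  have hn0 : (0 : ℝ) < n := by exact_mod_cast hn
  have hm1 : (1 : ℝ) ≤ m := by exact_mod_cast hn.trans (le_max_right M n)
  have hMm : (M : ℝ) ≤ m := by exact_mod_cast le_max_left M n
  unfold rMin at hr
  rw [← hm] at hr
  have hl1 : 0 ≤ Real.log (2 * m) := Real.log_nonneg (by linarith)
  have hl2 : 0 ≤ Real.log (1 / δ) := Real.log_nonneg (by rw [le_div_iff₀ hδ]; linarith)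
  set p := √(2 * Real.log (2 * m) / n) with hp
  set q := √(2 * Real.log (1 / δ) / n) with hq
  have hp0 : 0 ≤ p := Real.sqrt_nonneg _
  have hq0 : 0 ≤ q := Real.sqrt_nonneg _
  have hp2 : p ^ 2 = 2 * Real.log (2 * m) / n := Real.sq_sqrt (by positivity)
  have hq2 : q ^ 2 = 2 * Real.log (1 / δ) / n := Real.sq_sqrt (by positivity)
  have hm4 : 0 < 1 / (4 * (m : ℝ)) := by positivity
  have hroot : 0 ≤ √2 := Real.sqrt_nonneg 2
  have hLp : 0 ≤ L * p := by positivity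
  have hLq : 0 ≤ L * q := by positivity
  have hcoef : 2 * (L * p) ≤ (6 + 4 * √2) * L * p := by nlinarith
  have hr0 : 0 < r := by nlinarith
  refine ⟨hr0, ?_⟩
  -- Only this part of `rMin` is needed: `p ^ 2 + q ^ 2 = 2 log (2m / δ) / n` is exactly the
  -- Hoeffding level with union bound over at most `m` coordinates.
  have hr2 : L * (p + q) ≤ r / 2 := by nlinarith
  have hsq : L ^ 2 * (2 * (Real.log (2 * m) + Real.log (1 / δ)) / n) ≤ (r / 2) ^ 2 := by
    have h1 : (L * (p + q)) ^ 2 ≤ (r / 2) ^ 2 := by gcongr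
    have h2 : L ^ 2 * (2 * (Real.log (2 * m) + Real.log (1 / δ)) / n) = L ^ 2 * (p ^ 2 + q ^ 2) := by
      rw [hp2, hq2]; ring
    have h3 : L ^ 2 * (p ^ 2 + q ^ 2) ≤ (L * (p + q)) ^ 2 := by
      have : 0 ≤ L ^ 2 * (p * q) := by positivity
      nlinarith
    linarith
  have hexp : -(n * (r / 2)) ^ 2 / (2 * (n * L ^ 2)) ≤ Real.log (δ / (2 * m)) := by
    have h1 : Real.log (δ / (2 * m)) = -(Real.log (2 * m) + Real.log (1 / δ)) := by
      rw [Real.log_div hδ.ne' (by positivity), one_div, Real.log_inv]; ring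
    rw [h1, div_le_iff₀ (by positivity)]
    have h2 := mul_le_mul_of_nonneg_left hsq (by positivity : (0 : ℝ) ≤ (n : ℝ) ^ 2)
    have h3 : (n : ℝ) ^ 2 * (L ^ 2 * (2 * (Real.log (2 * m) + Real.log (1 / δ)) / n)) =
        (Real.log (2 * m) + Real.log (1 / δ)) * (2 * (n * L ^ 2)) := by
      field_simp
    rw [h3] at h2
    linarith
  have hle : Real.exp (-(n * (r / 2)) ^ 2 / (2 * (n * L ^ 2))) ≤ δ / (2 * m) := by
    rw [← Real.exp_log (by positivity : 0 < δ / (2 * m))]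
    exact Real.exp_le_exp.2 hexp
  calc _ ≤ 2 * (m : ℝ) * (δ / (2 * m)) := by gcongr
    _ = δ := by field_simp

end ElasticNetLogistic

end

open ElasticNetLogistic in
/-- The constant `s = s(L, D)` is positive, depends on `L` and `D` only, and decreases with `D`. -/
theorem theorem2p7 :
    ∃ s : ℝ → ℝ → ℝ,
      (∀ L > 0, ∀ D > 0, 0 < s L D) ∧
      (∀ L > 0, StrictAntiOn (s L) (Set.Ioi 0)) ∧
      ∀ (Ω : Type*) [MeasurableSpace Ω] (μ : Measure Ω) [IsProbabilityMeasure μ]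
        (n M : ℕ) (X : Fin n → Ω → Fin M → ℝ) (Y : Fin n → Ω → ℝ)
        (I : Finset (Fin M)) (βstar : Fin M → ℝ) (βtilde : Ω → Fin M → ℝ)
        (L D B b δ r c : ℝ),
        1 ≤ n → 0 < L → 0 < D → 0 < B → 0 < b → b ≤ 1 → 0 < δ → δ < 1 →
        IsLogisticSample μ X Y I βstar →
        (∀ i j, ∀ᵐ ω ∂μ, |X i ω j| ≤ L) →
        l1Norm βstar ≤ D →
        (∀ j, |βstar j| ≤ B) →
        rMin L n M δ ≤ r →
        c = r / (2 * B) →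
        Stabil μ X I 4 (eps n M r) b →
        (∀ ω, IsEstimate (fun i => X i ω) (fun i => Y i ω) r c (βtilde ω)) →
        1 - δ ≤ μ.real {ω | l1Norm (βtilde ω - βstar) ≤
          4.25 * r * (I.card : ℝ) / (s L D * b + c) + (1 + 1 / r) * eps n M r} := by
  refine ⟨fun L D => Real.exp (-(4 * L * D)) / 8, fun _ _ _ _ => by positivity, ?_, ?_⟩
  · intro L hL D _ D' _ hDD
    have : Real.exp (-(4 * L * D')) < Real.exp (-(4 * L * D)) :=
      Real.exp_lt_exp.2 (by nlinarith)
    exact div_lt_div_of_pos_right this (by norm_num)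
  intro Ω _ μ _ n M X Y I βstar βtilde L D B b δ r c hn hL _ hB hb _ hδ hδ1 hmodel hX hD hβB hr hc
    hstabil hest
  obtain ⟨hr0, hδ'⟩ := two_mul_exp_le_of_rMin_le hn hL hδ hδ1 hr
  have hε : 0 ≤ eps n M r := by
    have := Real.log_nonneg (by norm_num : (1 : ℝ) ≤ 2)
    unfold eps
    positivity
  have hn0 : (0 : ℝ) < n := by exact_mod_cast hn
  have hbad := (hmodel.measureReal_exists_score_ge_le hL hX
    (by positivity : 0 ≤ (n : ℝ) * (r / 2))).trans hδ'
  set bad := {ω | ∃ j, (n : ℝ) * (r / 2) ≤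
    |∑ i, (Y i ω - link (∑ k, βstar k * X i ω k)) * X i ω j|}
  set good := {ω | l1Norm (βtilde ω - βstar) ≤ 4.25 * r * (I.card : ℝ) /
    (Real.exp (-(4 * L * D)) / 8 * b + c) + (1 + 1 / r) * eps n M r}
  -- No measurability of `βtilde` is assumed, so `good` need not be measurable. Covering almost
  -- everything by `good ∪ bad` and using subadditivity avoids complements.
  have hcover : ∀ᵐ ω ∂μ, ω ∈ good ∪ bad := by
    have hX' : ∀ᵐ ω ∂μ, ∀ i j, |X i ω j| ≤ L :=
      ae_all_iff.2 fun i => ae_all_iff.2 fun j => hX i j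
    filter_upwards [hX', hstabil.ae_forall] with ω hXω hSω
    by_cases hω : ω ∈ bad
    · exact Or.inr hω
    · refine Or.inl (l1Norm_estimate_sub_le (fun i => X i ω) (fun i => Y i ω) I βstar (βtilde ω) hn
        hL hB hb hr0 hε hc hXω hD hβB hmodel.eq_zero (fun j => ?_) hSω (hest ω))
      exact (not_le.1 fun hj => hω ⟨j, hj⟩).le
  have hone : μ.real (good ∪ bad) = 1 := by
    rw [measureReal_def, measure_congr (s := good ∪ bad) (t := Set.univ)
      (Filter.eventuallyEq_univ.2 hcover), measure_univ, ENNReal.toReal_one]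
  have := measureReal_union_le (μ := μ) good bad
  change 1 - δ ≤ μ.real good
  linarith
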